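/- Logarithms are to base $2$. Let $n=2^L$ and $d\ge 1$. An $n$-input multi-butterfly of multiplicity $d$ is a directed multigraph with levels $0,\dots,L$, each level having one node for every binary string (row) of length $L$. The nodes of level $0$ are the inputs and those of level $L$ are the outputs. For each $\ell<L$ and each string $w$ of length $\ell$, the $M=2^{L-\ell}$ nodes of level $\ell$ whose rows begin with $w$ are the inputs of a splitter. Its upper (lower) outputs are the $M/2$ nodes of level $\ell+1$ whose rows begin with $w0$ (with $w1$). Every splitter input has $d$ edges to upper outputs and $d$ edges to lower outputs, and every splitter output has $2d$ incoming edges (parallel edges are allowed), so that there are $2d\,n\log n=\Theta(n\log n)$ edges in total. The multi-butterfly has $(\alpha,\beta)$-expansion if in every splitter, with $M$ inputs say, every set of $k\le \alpha M$ inputs has at least $\beta k$ neighbours among the upper outputs and at least $\beta k$ neighbours among the lower outputs. **Theorem.** For every $d\ge1$, $\alpha>0$ and $\beta>1$ there are constants $c,C>0$, depending only on $d,\alpha,\beta$, such that the following holds for every $n=2^L\ge 8$ and every $n$-input multi-butterfly of multiplicity $d$ with $(\alpha,\beta)$-expansion. Put $\rho(n)=\frac{\log\log n}{\log\log\log n}$.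 Given any $n\log n$ source-destination pairs (repetitions allowed) such that every input is the source of exactly $\log n$ pairs and every output is the destination of exactly $\log n$ pairs, one can select at least $c\,n\,\rho(n)$ of the pairs and choose for each selected pair a directed path from its source to its destination such that every edge lies on at most $C\rho(n)$ of the chosen paths, every input is the source of at most $C\rho(n)$ selected pairs, and every output is the destination of at most $C\rho(n)$ selected pairs. -/

import Mathlib

/-- Rows of a network with `n = 2 ^ L` inputs: binary strings of length `L = log n`. -/
abbrev Row (L : ℕ) : Type := Fin L → Bool

/-- A multi-butterfly with `n = 2 ^ L` inputs and multiplicity `d`.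

It has levels `0, …, L`, with one node per row on each level; the inputs are the nodes of level `0`
and the outputs are the nodes of level `L`.  For `ℓ < L` the nodes of level `ℓ` whose rows
have the same first `ℓ` bits `w` are the `M = 2 ^ (L - ℓ)` inputs of a splitter.  Its `M / 2` upper
(lower) outputs are the nodes of level `ℓ + 1` whose rows begin with `w` followed by `false`
(`true`).  Every splitter input has `d` edges to upper and `d` edges to lower outputs,
and every splitter output has `2 * d` incoming edges (parallel edges are allowed).

`head ℓ r b k` is the row of the head of the `k`-th edge that leaves the node in row `r` of
level `ℓ` in direction `b`. -/
structure MultiButterfly (L d : ℕ) where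
  head : Fin L → Row L → Bool → Fin d → Row L
  head_prefix : ∀ (l : Fin L) (r : Row L) (b : Bool) (k : Fin d) (j : Fin L),
    j < l → head l r b k j = r j
  head_bit : ∀ (l : Fin L) (r : Row L) (b : Bool) (k : Fin d), head l r b k l = b
  in_degree : ∀ (l : Fin L) (w : Row L),
    (Finset.univ.filter fun x : Row L × Bool × Fin d => head l x.1 x.2.1 x.2.2 = w).card = 2 * d

namespace MultiButterfly

variable {L d : ℕ}

/-- The edges, as (level of the tail, row of the tail, direction, index).
There are `2 * d * n * log n` of them. -/
abbrev Edge (L d : ℕ) : Type := Fin L × Row L × Bool × Fin d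

/-- The heads of the edges that leave, in direction `b`, the nodes of level `l` with rows in `S`. -/
def neighbors (G : MultiButterfly L d) (l : Fin L) (S : Finset (Row L)) (b : Bool) :
    Finset (Row L) :=
  S.biUnion fun r => Finset.univ.image fun k => G.head l r b k

/-- `(α, β)`-expansion: in every splitter, with `M` inputs say, every set of `k ≤ α M` inputs has
at least `β k` neighbors among the upper outputs and at least `β k` among the lower outputs. -/
def HasExpansion (G : MultiButterfly L d) (α β : ℝ) : Prop :=
  ∀ (l : Fin L) (S : Finset (Row L)),
    (∀ r ∈ S, ∀ r' ∈ S, ∀ j : Fin L, j < l → r j = r' j) →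
    (S.card : ℝ) ≤ α * 2 ^ (L - (l : ℕ)) →
    ∀ b : Bool, β * (S.card : ℝ) ≤ ((G.neighbors l S b).card : ℝ)

/-- A directed path from the input in row `s` to the output in row `t`. -/
structure Route (G : MultiButterfly L d) (s t : Row L) where
  row : Fin (L + 1) → Row L
  dir : Fin L → Bool
  idx : Fin L → Fin d
  row_zero : row 0 = s
  row_last : row (Fin.last L) = t
  step : ∀ l : Fin L, G.head l (row l.castSucc) (dir l) (idx l) = row l.succ

/-- The edges of a path. -/
def Route.edges {G : MultiButterfly L d} {s t : Row L} (p : G.Route s t) : Finset (Edge L d) :=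
  Finset.univ.image fun l : Fin L => (l, p.row l.castSucc, p.dir l, p.idx l)

end MultiButterfly

/-- `log log n / log log log n`, with logarithms to base `2`. -/
noncomputable def congestionRate (n : ℕ) : ℝ :=
  Real.logb 2 (Real.logb 2 n) / Real.logb 2 (Real.logb 2 (Real.logb 2 n))

/-! The pairs form a regular bipartite multigraph, so they split into `L = log n` colour classes,
each a permutation (`exists_edge_coloring_of_regular`). Keep about `ρ(n)` classes and, in them, only
destinations ending in `q` zeros, where `2 ^ (-q) < α`. This keeps a constant fraction of each
class, yet a splitter with `M` inputs receives at most `α M` packets of one class, or at most one.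
Expansion and Hall's theorem then move the class from level to level along node-disjoint paths
(`exists_disjoint_routes`). Each class thus adds at most one to the load of any edge, input or
output. -/

open Finset

/-! ### Matchings and edge colourings -/

/-- A regular bipartite multigraph has a perfect matching. -/
theorem exists_perfect_matching_of_regular {ι V : Type*} [DecidableEq ι] [Fintype V]
    [DecidableEq V] (src dst : ι → V) (m : ℕ) (hm : 0 < m) (I : Finset ι)
    (hsrc : ∀ v, #{i ∈ I | src i = v} = m) (hdst : ∀ v, #{i ∈ I | dst i = v} = m) :
    ∃ p : V → ι, (∀ v, p v ∈ I) ∧ (∀ v, dst (p v) = v) ∧ Function.Bijective fun v => src (p v) := by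
  let N : V → Finset V := fun v => {i ∈ I | dst i = v}.image src
  -- Double counting: the `m * #A` edges at `A` are among the `m * #(N A)` edges at its
  -- neighbourhood.
  have hall : ∀ A : Finset V, #A ≤ #(A.biUnion N) := by
    intro A
    have h1 : #{i ∈ I | dst i ∈ A} = #A * m := by
      rw [card_eq_sum_card_fiberwise (f := dst) (t := A) (fun i hi => by simpa using
        (mem_filter.1 hi).2), sum_const_nat]
      intro v hv
      rw [← hdst v, filter_filter]
      congr 1
      ext i
      simp only [mem_filter]
      constructor
      · rintro ⟨h, -, h'⟩; exact ⟨h, h'⟩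
      · rintro ⟨h, rfl⟩; exact ⟨h, hv, rfl⟩
    have h2 : #{i ∈ I | src i ∈ A.biUnion N} = #(A.biUnion N) * m := by
      rw [card_eq_sum_card_fiberwise (f := src) (t := A.biUnion N) (fun i hi => by simpa using
        (mem_filter.1 hi).2), sum_const_nat]
      intro v hv
      rw [← hsrc v, filter_filter]
      congr 1
      ext i
      simp only [mem_filter]
      constructor
      · rintro ⟨h, -, h'⟩; exact ⟨h, h'⟩
      · rintro ⟨h, rfl⟩; exact ⟨h, hv, rfl⟩
    have h3 : #{i ∈ I | dst i ∈ A} ≤ #{i ∈ I | src i ∈ A.biUnion N} := by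
      refine card_le_card fun i hi => ?_
      rw [mem_filter] at hi ⊢
      exact ⟨hi.1, mem_biUnion.2 ⟨dst i, hi.2, mem_image.2 ⟨i, by simp [hi.1], rfl⟩⟩⟩
    rw [h1, h2] at h3
    exact Nat.le_of_mul_le_mul_right h3 hm
  obtain ⟨f, hf, hfN⟩ := (all_card_le_biUnion_card_iff_exists_injective N).1 hall
  have : ∀ v, ∃ i ∈ I, dst i = v ∧ src i = f v := by
    intro v
    obtain ⟨i, hi, h⟩ := mem_image.1 (hfN v)
    rw [mem_filter] at hi
    exact ⟨i, hi.1, hi.2, h⟩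
  choose p hpI hpd hps using this
  refine ⟨p, hpI, hpd, ?_⟩
  simp only [hps]
  exact Finite.injective_iff_bijective.1 hf

/-- An `m`-regular bipartite multigraph has a proper edge colouring with `m` colours. -/
theorem exists_edge_coloring_of_regular {ι V : Type*} [DecidableEq ι] [Fintype V]
    [DecidableEq V] (src dst : ι → V) (m : ℕ) (I : Finset ι)
    (hsrc : ∀ v, #{i ∈ I | src i = v} = m) (hdst : ∀ v, #{i ∈ I | dst i = v} = m) :
    ∃ c : ι → ℕ, (∀ i ∈ I, c i < m) ∧
      ∀ i ∈ I, ∀ j ∈ I, c i = c j → (src i = src j ∨ dst i = dst j) → i = j := by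
  induction m generalizing I with
  | zero =>
    have : ∀ i, i ∉ I := by
      intro i hi
      have := hsrc (src i)
      rw [card_eq_zero] at this
      exact notMem_empty i (this ▸ mem_filter.2 ⟨hi, rfl⟩)
    exact ⟨fun _ => 0, fun i hi => (this i hi).elim, fun i hi => (this i hi).elim⟩
  | succ m ih =>
    obtain ⟨p, hpI, hpd, hps⟩ := exists_perfect_matching_of_regular src dst (m + 1) m.succ_pos I
      hsrc hdst
    -- Deleting the matching lowers every degree by one; stated for `f` to serve both sides.
    have hfib : ∀ f : ι → V, (∀ v, #{i ∈ I | f i = v} = m + 1) →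
        Function.Bijective (fun v => f (p v)) →
        ∀ v, #{i ∈ I \ univ.image p | f i = v} = m := by
      intro f hf hb v
      obtain ⟨u, hu⟩ := hb.2 v
      have : {i ∈ I \ univ.image p | f i = v} = {i ∈ I | f i = v}.erase (p u) := by
        ext i
        simp only [mem_filter, mem_sdiff, mem_image, mem_univ, true_and, mem_erase, not_exists]
        constructor
        · rintro ⟨⟨h1, h2⟩, h3⟩
          exact ⟨fun h => h2 u h.symm, h1, h3⟩
        · rintro ⟨h1, h2, h3⟩
          refine ⟨⟨h2, fun w hw => h1 ?_⟩, h3⟩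
          rw [← hw, hb.1 (show f (p w) = f (p u) by rw [hw, h3, ← hu])]
      rw [this, card_erase_of_mem (mem_filter.2 ⟨hpI u, hu⟩), hf v, Nat.add_sub_cancel]
    have hbd : Function.Bijective fun v => dst (p v) := by
      simp only [hpd]; exact Function.bijective_id
    obtain ⟨c, hc, hinj⟩ := ih (I \ univ.image p) (hfib src hsrc hps) (hfib dst hdst hbd)
    refine ⟨fun i => if i ∈ univ.image p then m else c i, ?_, ?_⟩
    · intro i hi
      dsimp only
      split_ifs with h
      · exact m.lt_succ_self
      · exact (hc i (mem_sdiff.2 ⟨hi, h⟩)).trans m.lt_succ_self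
    · intro i hi j hj hij hor
      dsimp only at hij
      split_ifs at hij with h h' h'
      · obtain ⟨u, -, rfl⟩ := mem_image.1 h
        obtain ⟨v, -, rfl⟩ := mem_image.1 h'
        rcases hor with ho | ho
        · rw [hps.1 ho]
        · rw [hbd.1 ho]
      · exact absurd hij (hc j (mem_sdiff.2 ⟨hj, h'⟩)).ne'
      · exact absurd hij (hc i (mem_sdiff.2 ⟨hi, h⟩)).ne
      · exact hinj i (mem_sdiff.2 ⟨hi, h⟩) j (mem_sdiff.2 ⟨hj, h'⟩) hij hor

/-! ### Node-disjoint routing -/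

namespace MultiButterfly

variable {L d : ℕ}

/-- Packets on distinct nodes of a level, few of them in each splitter, can advance to distinct
nodes of the next level, each in its own direction. -/
theorem exists_injOn_step (hd : 0 < d) {α β : ℝ} (hβ : 1 < β) (G : MultiButterfly L d)
    (hG : G.HasExpansion α β) {ι : Type*} (I : Finset ι) (dst : ι → Row L)
    (hsparse : ∀ (l : ℕ) (w : Row L),
      #{i ∈ I | ∀ j : Fin L, (j : ℕ) < l → dst i j = w j} ≤ 1 ∨
      (#{i ∈ I | ∀ j : Fin L, (j : ℕ) < l → dst i j = w j} : ℝ) ≤ α * 2 ^ (L - l))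
    (l : Fin L) (r : ι → Row L) (hr : Set.InjOn r I)
    (hpre : ∀ i ∈ I, ∀ j : Fin L, j < l → r i j = dst i j) :
    ∃ k : ι → Fin d, Set.InjOn (fun i => G.head l (r i) (dst i l) (k i)) I := by
  classical
  let N : I → Finset (Row L) := fun i => univ.image fun k => G.head l (r i) (dst i l) k
  -- The first `l + 1` bits, padded with `false`, name a splitter and one half of its outputs.
  -- Packets with different keys never compete, so Hall's condition is checked key by key.
  let key : Row L → Row L := fun w j => if j ≤ l then w j else false
  have hkey : ∀ i ∈ I, ∀ k, key (G.head l (r i) (dst i l) k) = key (dst i) := by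
    intro i hi k
    funext j
    simp only [key]
    split_ifs with h
    · rcases h.lt_or_eq with h | rfl
      · rw [G.head_prefix l _ _ _ j h, hpre i hi j h]
      · rw [G.head_bit]
    · rfl
  have hkey_eq : ∀ w w' : Row L, key w = key w' → ∀ j, j ≤ l → w j = w' j := by
    intro w w' h j hj
    have := congrFun h j
    simpa [key, hj] using this
  have hall : ∀ A : Finset I, #A ≤ #(A.biUnion N) := by
    intro A
    rw [card_eq_sum_card_fiberwise (f := fun i : I => key (dst i))
        (t := A.image fun i : I => key (dst i)) (fun i hi => mem_coe.2 (mem_image_of_mem _ hi)),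
      card_eq_sum_card_fiberwise (s := A.biUnion N) (f := key)
        (t := A.image fun i : I => key (dst i))]
    · refine sum_le_sum fun c hc => ?_
      obtain ⟨a, haA, hac⟩ := mem_image.1 hc
      set B : Finset I := {i ∈ A | key (dst i) = c} with hB
      have haB : a ∈ B := mem_filter.2 ⟨haA, hac⟩
      have hBN : ∀ i ∈ B, N i ⊆ {x ∈ A.biUnion N | key x = c} := by
        intro i hi x hx
        rw [hB, mem_filter] at hi
        refine mem_filter.2 ⟨mem_biUnion.2 ⟨i, hi.1, hx⟩, ?_⟩
        obtain ⟨k, -, rfl⟩ := mem_image.1 hx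
        rw [hkey i i.2, hi.2]
      have hBa : ∀ i ∈ B, ∀ j, j ≤ l → dst i j = dst a j := by
        intro i hi
        exact hkey_eq _ _ ((mem_filter.1 hi).2.trans hac.symm)
      have hBcard : #B ≤ #{i ∈ I | ∀ j : Fin L, (j : ℕ) < l → dst i j = dst a j} := by
        refine card_le_card_of_injOn (fun i => (i : ι)) (fun i hi => ?_)
          Subtype.val_injective.injOn
        exact mem_coe.2 (mem_filter.2 ⟨i.2, fun j hj => hBa i hi j (Fin.le_of_lt hj)⟩)
      rcases hsparse l (dst a) with h | h
      -- A lone packet needs only one outgoing edge.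
      · refine (hBcard.trans h).trans (card_pos.2 ⟨G.head l (r a) (dst a l) ⟨0, hd⟩, ?_⟩)
        exact hBN a haB (mem_image_of_mem _ (mem_univ _))
      · have hS : #(B.image fun i : I => r i) = #B :=
          card_image_of_injOn fun i _ j _ hij => Subtype.ext (hr i.2 j.2 hij)
        have hexp := hG l (B.image fun i : I => r i) (by
          intro x hx y hy j hj
          obtain ⟨i, hi, rfl⟩ := mem_image.1 hx
          obtain ⟨i', hi', rfl⟩ := mem_image.1 hy
          rw [hpre i i.2 j hj, hpre i' i'.2 j hj, hBa i hi j hj.le, hBa i' hi' j hj.le])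
          (by rw [hS]; exact (Nat.cast_le.2 hBcard).trans h) (dst a l)
        rw [hS] at hexp
        have hsub : G.neighbors l (B.image fun i : I => r i) (dst a l) ⊆
            {x ∈ A.biUnion N | key x = c} := by
          intro x hx
          obtain ⟨y, hy, hx⟩ := mem_biUnion.1 hx
          obtain ⟨i, hi, rfl⟩ := mem_image.1 hy
          refine hBN i hi ?_
          rw [← hBa i hi l le_rfl] at hx
          exact hx
        have h0 : (0 : ℝ) ≤ #B := Nat.cast_nonneg _
        have h1 : (#B : ℝ) ≤ #(G.neighbors l (B.image fun i : I => r i) (dst a l)) :=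
          le_trans (le_mul_of_one_le_left h0 hβ.le) hexp
        exact (Nat.cast_le.1 h1).trans (card_le_card hsub)
    · intro x hx
      obtain ⟨i, hi, hx⟩ := mem_biUnion.1 (mem_coe.1 hx)
      obtain ⟨k, -, rfl⟩ := mem_image.1 hx
      rw [hkey i i.2]
      exact mem_coe.2 (mem_image_of_mem (fun i : I => key (dst i)) hi)
  obtain ⟨f, hf, hfN⟩ := (all_card_le_biUnion_card_iff_exists_injective N).1 hall
  have hk : ∀ i : I, ∃ k, G.head l (r i) (dst i l) k = f i := fun i => by
    obtain ⟨k, -, h⟩ := mem_image.1 (hfN i)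
    exact ⟨k, h⟩
  choose k hk using hk
  refine ⟨fun i => if h : i ∈ I then k ⟨i, h⟩ else ⟨0, hd⟩, ?_⟩
  intro i hi j hj hij
  have hi' : i ∈ I := hi
  have hj' : j ∈ I := hj
  simp only [dif_pos hi', dif_pos hj'] at hij
  have := hf ((hk ⟨i, hi⟩).symm.trans (hij.trans (hk ⟨j, hj⟩)))
  exact congrArg Subtype.val this

/-- A partial permutation that loads every splitter lightly can be routed along node-disjoint
paths. -/
theorem exists_disjoint_routes (hd : 0 < d) {α β : ℝ} (hβ : 1 < β) (G : MultiButterfly L d)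
    (hG : G.HasExpansion α β) {ι : Type*} (I : Finset ι) (src dst : ι → Row L)
    (hsrc : Set.InjOn src I)
    (hsparse : ∀ (l : ℕ) (w : Row L),
      #{i ∈ I | ∀ j : Fin L, (j : ℕ) < l → dst i j = w j} ≤ 1 ∨
      (#{i ∈ I | ∀ j : Fin L, (j : ℕ) < l → dst i j = w j} : ℝ) ≤ α * 2 ^ (L - l)) :
    ∃ P : ∀ i ∈ I, G.Route (src i) (dst i),
      ∀ i hi j hj l, (P i hi).row l = (P j hj).row l → i = j := by
  let Good : ℕ → (ι → Row L) → Prop := fun l r =>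
    Set.InjOn r I ∧ ∀ i ∈ I, ∀ j : Fin L, (j : ℕ) < l → r i j = dst i j
  -- Stated for all `l` and `r`, with `r' = r` as a default, so that the chosen step can be iterated
  -- by `Nat.rec`.
  have hstep : ∀ (l : ℕ) (r : ι → Row L), ∃ r' : ι → Row L, Good l r → Good (l + 1) r' ∧
      ∀ h : l < L, ∃ k : ι → Fin d, ∀ i, G.head ⟨l, h⟩ (r i) (dst i ⟨l, h⟩) (k i) = r' i := by
    intro l r
    by_cases hg : Good l r
    · by_cases h : l < L
      · obtain ⟨k, hk⟩ := exists_injOn_step hd hβ G hG I dst hsparse ⟨l, h⟩ r hg.1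
          (fun i hi j hj => hg.2 i hi j hj)
        refine ⟨_, fun _ => ⟨⟨hk, fun i hi j hj => ?_⟩, fun _ => ⟨k, fun _ => rfl⟩⟩⟩
        rcases (Nat.lt_succ_iff.1 hj).lt_or_eq with hj | hj
        · rw [G.head_prefix ⟨l, h⟩ _ _ _ j hj, hg.2 i hi j hj]
        · obtain rfl : j = ⟨l, h⟩ := Fin.ext hj
          exact G.head_bit _ _ _ _
      · exact ⟨r, fun _ => ⟨⟨hg.1, fun i hi j _ => hg.2 i hi j (by omega)⟩, fun h' => (h h').elim⟩⟩
    · exact ⟨r, fun h => (hg h).elim⟩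
  choose next hnext using hstep
  let row : ℕ → ι → Row L := fun l => Nat.rec src next l
  have hgood : ∀ l, Good l (row l) := by
    intro l
    induction l with
    | zero => exact ⟨hsrc, fun _ _ j hj => (Nat.not_lt_zero _ hj).elim⟩
    | succ l ih => exact (hnext l (row l) ih).1
  have hhead : ∀ l : Fin L, ∃ k : ι → Fin d,
      ∀ i, G.head l (row l i) (dst i l) (k i) = row (l + 1) i :=
    fun l => (hnext l (row l) (hgood l)).2 l.2
  choose k hk using hhead
  refine ⟨fun i hi =>
    { row := fun l => row l i
      dir := dst i
      idx := fun l => k l i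
      row_zero := rfl
      row_last := funext fun j => (hgood L).2 i hi j j.2
      step := fun l => hk l i }, ?_⟩
  intro i hi j hj l h
  exact (hgood l).1 hi hj h

end MultiButterfly

/-! ### A sparse, evenly spread set of outputs -/

/-- The rows that end with `q` zeros. -/
def Row.endingInZeros (L q : ℕ) : Finset (Row L) :=
  {t | ∀ j : Fin L, L ≤ j + q → t j = false}

/-- Only the bits between the first `l` and the last `q` are free; truncated subtraction covers the
overlap. -/
theorem Row.card_endingInZeros_filter (L q l : ℕ) (w : Row L) :
    #{t ∈ Row.endingInZeros L q | ∀ j : Fin L, (j : ℕ) < l → t j = w j} ≤ 2 ^ (L - q - l) := by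
  have hsub : #{t ∈ Row.endingInZeros L q | ∀ j : Fin L, (j : ℕ) < l → t j = w j} ≤
      #(univ : Finset (Fin (L - q - l) → Bool)) := by
    refine card_le_card_of_injOn (fun t x => t ⟨l + x, by omega⟩)
      (fun _ _ => mem_coe.2 (mem_univ _)) ?_
    intro t ht t' ht' h
    simp only [Row.endingInZeros, coe_filter, mem_filter, mem_univ, true_and,
      Set.mem_ofPred_eq] at ht ht'
    funext j
    by_cases h1 : (j : ℕ) < l
    · rw [ht.2 j h1, ht'.2 j h1]
    · by_cases h2 : L ≤ j + q
      · rw [ht.1 j h2, ht'.1 j h2]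
      · have := congrFun h ⟨j - l, by omega⟩
        have hj : (⟨l + (j - l), by omega⟩ : Fin L) = j := Fin.ext (by simp; omega)
        simpa only [hj] using this
  simpa using hsub

theorem Row.two_pow_le_card_endingInZeros (L q : ℕ) :
    2 ^ (L - q) ≤ #(Row.endingInZeros L q) := by
  have h : #(univ : Finset (Fin (L - q) → Bool)) ≤ #(Row.endingInZeros L q) := by
    refine card_le_card_of_injOn
      (fun x j => if h : (j : ℕ) < L - q then x ⟨j, h⟩ else false) ?_ ?_
    · intro x _
      refine mem_coe.2 (mem_filter.2 ⟨mem_univ _, fun j hj => ?_⟩)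
      exact dif_neg (by omega)
    · intro x _ y _ h
      funext j
      have := congrFun h ⟨j, by omega⟩
      simpa using this
  simpa using h

/-! ### Estimates for the congestion rate -/

theorem logb_two_three_bounds {L : ℕ} (hL : 3 ≤ L) :
    1 < Real.logb 2 3 ∧ Real.logb 2 3 ≤ Real.logb 2 L ∧ Real.logb 2 L ≤ L := by
  have hL' : (3 : ℝ) ≤ L := by exact_mod_cast hL
  refine ⟨?_, Real.logb_le_logb_of_le (by norm_num) (by norm_num) hL', ?_⟩
  · rw [Real.lt_logb_iff_rpow_lt (by norm_num) (by norm_num)]; norm_num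
  · rw [Real.logb_le_iff_le_rpow (by norm_num) (by linarith), Real.rpow_natCast]
    exact_mod_cast Nat.lt_two_pow_self.le

theorem logb_two_le_self {x : ℝ} (hx : 1 < x) : Real.logb 2 x ≤ x := by
  rw [Real.logb_le_iff_le_rpow (by norm_num) (by linarith)]
  have := one_add_mul_self_le_rpow_one_add (s := 1) (by norm_num) hx.le
  norm_num at this
  linarith

theorem congestionRate_two_pow (L : ℕ) :
    congestionRate (2 ^ L) = Real.logb 2 L / Real.logb 2 (Real.logb 2 L) := by
  have : Real.logb 2 ((2 ^ L : ℕ) : ℝ) = L := by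
    push_cast
    rw [← Real.rpow_natCast, Real.logb_rpow (by norm_num) (by norm_num)]
  rw [congestionRate, this]

theorem one_le_congestionRate {L : ℕ} (hL : 3 ≤ L) : 1 ≤ congestionRate (2 ^ L) := by
  obtain ⟨h1, h2, -⟩ := logb_two_three_bounds hL
  have hx : 1 < Real.logb 2 L := h1.trans_le h2
  rw [congestionRate_two_pow, one_le_div (Real.logb_pos (by norm_num) hx)]
  exact logb_two_le_self hx

theorem congestionRate_le {L : ℕ} (hL : 3 ≤ L) :
    congestionRate (2 ^ L) * Real.logb 2 (Real.logb 2 3) ≤ L := by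
  obtain ⟨h1, h2, h3⟩ := logb_two_three_bounds hL
  have hx : 1 < Real.logb 2 L := h1.trans_le h2
  have hK := Real.logb_le_logb_of_le (b := 2) (by norm_num) (by linarith) h2
  have hpos : 0 < Real.logb 2 (Real.logb 2 L) := Real.logb_pos (by norm_num) hx
  rw [congestionRate_two_pow, div_mul_eq_mul_div, div_le_iff₀ hpos]
  exact mul_le_mul h3 hK (Real.logb_pos (by norm_num) h1).le (Nat.cast_nonneg _)

/-- A number of rounds `m ≤ log n` that is within a constant factor of the congestion rate. -/
theorem exists_rounds : ∃ a : ℝ, 0 < a ∧ ∀ L : ℕ, 3 ≤ L → ∃ m : ℕ, m ≤ L ∧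
    (m : ℝ) ≤ congestionRate (2 ^ L) ∧ a * congestionRate (2 ^ L) ≤ m := by
  have hK : 0 < Real.logb 2 (Real.logb 2 3) :=
    Real.logb_pos (by norm_num) (logb_two_three_bounds le_rfl).1
  -- The factor `1 / 2` pays for rounding `ρ` down, the other for capping at `L`.
  refine ⟨min (1 / 2) (Real.logb 2 (Real.logb 2 3)), lt_min (by norm_num) hK, fun L hL => ?_⟩
  have h1 := one_le_congestionRate hL
  have h2 := congestionRate_le hL
  set ρ := congestionRate (2 ^ L)
  have hfl : (⌊ρ⌋₊ : ℝ) ≤ ρ := Nat.floor_le (by linarith)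
  refine ⟨min ⌊ρ⌋₊ L, min_le_right _ _, (Nat.cast_le.2 (min_le_left _ _)).trans hfl, ?_⟩
  rw [Nat.cast_min]
  refine le_min ?_ ?_
  · have h3 : (1 : ℝ) ≤ ⌊ρ⌋₊ := by exact_mod_cast (Nat.one_le_floor_iff ρ).2 h1
    have h4 := Nat.lt_floor_add_one ρ
    have h5 := mul_le_mul_of_nonneg_right
      (min_le_left (1 / 2) (Real.logb 2 (Real.logb 2 3))) (by linarith : 0 ≤ ρ)
    linarith
  · have h5 := mul_le_mul_of_nonneg_right
      (min_le_right (1 / 2) (Real.logb 2 (Real.logb 2 3))) (by linarith : 0 ≤ ρ)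
    linarith

/-! ### Selection and routing of the pairs -/

theorem mainTheorem8 (d : ℕ) (hd : 0 < d) (α β : ℝ) (hα : 0 < α) (hβ : 1 < β) :
    ∃ c C : ℝ, 0 < c ∧ 0 < C ∧
      ∀ L : ℕ, 3 ≤ L →
      ∀ G : MultiButterfly L d, G.HasExpansion α β →
      -- an arbitrary instance: `n log n` pairs, `log n` sources per input, `log n` sinks per output
      ∀ src dst : Fin (2 ^ L * L) → Row L,
        (∀ v : Row L, (Finset.univ.filter fun i => src i = v).card = L) →
        (∀ v : Row L, (Finset.univ.filter fun i => dst i = v).card = L) →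
        -- some pairs `S` are selected, and every selected pair is routed along one path
        ∃ (S : Finset (Fin (2 ^ L * L))) (P : ∀ i : S, G.Route (src i) (dst i)),
          c * ((2 ^ L : ℕ) * congestionRate (2 ^ L)) ≤ (S.card : ℝ) ∧
          (∀ e : MultiButterfly.Edge L d,
            ((Finset.univ.filter fun i : S => e ∈ (P i).edges).card : ℝ)
              ≤ C * congestionRate (2 ^ L)) ∧
          (∀ v : Row L, ((S.filter fun i => src i = v).card : ℝ) ≤ C * congestionRate (2 ^ L)) ∧
          (∀ v : Row L, ((S.filter fun i => dst i = v).card : ℝ) ≤ C * congestionRate (2 ^ L)) := by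
  obtain ⟨a, ha, hrounds⟩ := exists_rounds
  obtain ⟨q, hq⟩ := exists_pow_lt_of_lt_one hα (by norm_num : (1 / 2 : ℝ) < 1)
  refine ⟨(1 / 2) ^ q * a, 1, by positivity, one_pos, ?_⟩
  intro L hL G hG src dst hsrc hdst
  obtain ⟨m, hmL, hmρ, haρ⟩ := hrounds L hL
  obtain ⟨c, hcL, hcinj⟩ := exists_edge_coloring_of_regular src dst L univ hsrc hdst
  have hcs : ∀ i j, c i = c j → src i = src j → i = j := fun i j h h' =>
    hcinj i (mem_univ _) j (mem_univ _) h (Or.inl h')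
  have hcd : ∀ i j, c i = c j → dst i = dst j → i = j := fun i j h h' =>
    hcinj i (mem_univ _) j (mem_univ _) h (Or.inr h')
  set T := Row.endingInZeros L q
  set S : Finset (Fin (2 ^ L * L)) := {i | c i < m ∧ dst i ∈ T} with hS
  have hmS : ∀ i ∈ S, c i < m := fun i hi => (mem_filter.1 hi).2.1
  have hroute := fun k : ℕ => MultiButterfly.exists_disjoint_routes hd hβ G hG
    {i ∈ S | c i = k} src dst
    (fun i hi j hj hij => hcs i j
      ((mem_filter.1 (mem_coe.1 hi)).2.trans (mem_filter.1 (mem_coe.1 hj)).2.symm) hij)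
    (by
      intro l w
      have hcard : #{i ∈ {i ∈ S | c i = k} | ∀ j : Fin L, (j : ℕ) < l → dst i j = w j} ≤
          2 ^ (L - q - l) := by
        refine le_trans (card_le_card_of_injOn dst ?_ ?_) (Row.card_endingInZeros_filter L q l w)
        · intro i hi
          simp only [hS, coe_filter, mem_filter, mem_univ, true_and, Set.mem_ofPred_eq] at hi ⊢
          exact ⟨hi.1.1.2, hi.2⟩
        · intro i hi j hj hij
          simp only [coe_filter, mem_filter, Set.mem_ofPred_eq] at hi hj
          exact hcd i j (hi.1.2.trans hj.1.2.symm) hij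
      -- Either at most one packet enters the splitter, or the bound equals `2 ^ (-q) * 2 ^ (L -
      -- l)`.
      by_cases h : L - q - l = 0
      · left; simpa [h] using hcard
      · right
        refine (Nat.cast_le.2 hcard).trans ?_
        have hL' : L - l = q + (L - q - l) := by omega
        rw [hL', pow_add, ← mul_assoc, Nat.cast_pow, Nat.cast_ofNat]
        refine le_mul_of_one_le_left (by positivity) ?_
        have : (1 / 2 : ℝ) ^ q * 2 ^ q = 1 := by rw [← mul_pow]; norm_num
        rw [← this]
        exact mul_le_mul_of_nonneg_right hq.le (by positivity))
  choose R hR using hroute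
  have hR' : ∀ k k', k = k' → ∀ i hi j hj l, (R k i hi).row l = (R k' j hj).row l → i = j := by
    rintro k _ rfl
    exact hR k
  -- All three load bounds reduce to this: distinct colours below `m`.
  have hle : ∀ {κ : Type} (A : Finset κ) (g : κ → Fin (2 ^ L * L)), (∀ i ∈ A, c (g i) < m) →
      (∀ i ∈ A, ∀ j ∈ A, c (g i) = c (g j) → i = j) →
      (#A : ℝ) ≤ 1 * congestionRate (2 ^ L) := by
    intro κ A g h1 h2
    rw [one_mul]
    refine le_trans (Nat.cast_le.2 ?_) hmρ
    rw [← card_range m]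
    exact card_le_card_of_injOn (fun i => c (g i)) (fun i hi => by simpa using h1 i hi)
      (fun i hi j hj => h2 i hi j hj)
  refine ⟨S, fun i => R (c i) i (mem_filter.2 ⟨i.2, rfl⟩), ?_, ?_, ?_, ?_⟩
  -- By cardinality this injection is onto: every output occurs in every colour, which gives `#T *
  -- m` selected pairs.
  · have hinj : Function.Injective fun i => (dst i, (⟨c i, hcL i (mem_univ _)⟩ : Fin L)) := by
      intro i j hij
      simp only [Prod.mk.injEq, Fin.mk.injEq] at hij
      exact hcd i j hij.2 hij.1
    have hsurj := ((Fintype.bijective_iff_injective_and_card _).2 ⟨hinj, by simp⟩).2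
    have hcard : #(T ×ˢ range m) ≤ #S := by
      refine card_le_card_of_surjOn (fun i => (dst i, c i)) ?_
      rintro ⟨t, k⟩ h
      obtain ⟨ht, hk⟩ := mem_product.1 (mem_coe.1 h)
      have hkm : k < m := mem_range.1 hk
      obtain ⟨i, hi⟩ := hsurj (t, ⟨k, hkm.trans_le hmL⟩)
      simp only [Prod.mk.injEq, Fin.mk.injEq] at hi
      obtain ⟨rfl, rfl⟩ := hi
      exact ⟨i, mem_coe.2 (mem_filter.2 ⟨mem_univ _, mem_range.1 hk, ht⟩), rfl⟩
    rw [card_product, card_range] at hcard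
    have hT : (1 / 2 : ℝ) ^ q * 2 ^ L ≤ #T := by
      have h1 : (2 : ℝ) ^ (L - q) ≤ #T := by
        exact_mod_cast Row.two_pow_le_card_endingInZeros L q
      have h2 : (2 : ℝ) ^ L ≤ 2 ^ q * 2 ^ (L - q) := by
        rw [← pow_add]
        exact pow_le_pow_right₀ (by norm_num) (by omega)
      have h3 : (1 / 2 : ℝ) ^ q * 2 ^ q = 1 := by rw [← mul_pow]; norm_num
      calc (1 / 2 : ℝ) ^ q * 2 ^ L ≤ (1 / 2) ^ q * (2 ^ q * 2 ^ (L - q)) := by gcongr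
        _ = 2 ^ (L - q) := by rw [← mul_assoc, h3, one_mul]
        _ ≤ #T := h1
    have hρ : 0 ≤ congestionRate (2 ^ L) := (Nat.cast_nonneg m).trans hmρ
    calc (1 / 2 : ℝ) ^ q * a * ((2 ^ L : ℕ) * congestionRate (2 ^ L))
        = ((1 / 2) ^ q * 2 ^ L) * (a * congestionRate (2 ^ L)) := by push_cast; ring
      _ ≤ #T * m := mul_le_mul hT haρ (by positivity) (Nat.cast_nonneg _)
      _ ≤ #S := by exact_mod_cast hcard
  · intro e
    refine hle _ (fun i : S => (i : Fin (2 ^ L * L))) (fun i _ => hmS i i.2) ?_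
    intro i hi j hj hij
    -- An edge records its tail, so routes sharing an edge share a node.
    obtain ⟨l, -, hl⟩ := mem_image.1 (mem_filter.1 hi).2
    obtain ⟨l', -, hl'⟩ := mem_image.1 (mem_filter.1 hj).2
    have h := hl.trans hl'.symm
    simp only [Prod.mk.injEq] at h
    obtain ⟨rfl, h, -⟩ := h
    exact Subtype.ext (hR' _ _ hij _ _ _ _ _ h)
  · intro v
    refine hle _ id (fun i hi => hmS i (mem_filter.1 hi).1) fun i hi j hj hij => ?_
    exact hcs i j hij ((mem_filter.1 hi).2.trans (mem_filter.1 hj).2.symm)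
  · intro v
    refine hle _ id (fun i hi => hmS i (mem_filter.1 hi).1) fun i hi j hj hij => ?_
    exact hcd i j hij ((mem_filter.1 hi).2.trans (mem_filter.1 hj).2.symm)
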